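/- Let $\mathbb{K}\in\{\mathbb{R},\mathbb{C}\}$, let $w=(w_j)_{j\in\mathbb{Z}}$ be a bounded sequence of non-zero scalars in $\mathbb{K}$, let $X=\ell^p(\mathbb{Z})$ with $1\le p<\infty$ or $X=c_0(\mathbb{Z})$ (over $\mathbb{K}$), and let $B_w\colon X\to X$, $(B_wx)_n=w_{n+1}x_{n+1}$ for $n\in\mathbb{Z}$, be the bilateral backward weighted shift with weight sequence $w$. Then the following five conditions are equivalent: 1. $\displaystyle\liminf_{n\to\infty}\prod_{j=-n+1}^{0}|w_j|=0$ and $\displaystyle\sup_{k\in\mathbb{Z},\,n\in\mathbb{N}}\prod_{j=k}^{k+n}|w_j|=\infty$; 2. $B_w$ has a Li-Yorke scrambled pair, i.e. there are $x,y\in X$ with $\liminf_{n\to\infty}\|B_w^nx-B_w^ny\|=0$ and $\limsup_{n\to\infty}\|B_w^nx-B_w^ny\|>0$; 3. $B_w$ is Li-Yorke chaotic, i.e. there is an uncountable set $S\subset X$ such that every pair of distinct points of $S$ is a Li-Yorke scrambled pair; 4. $B_w$ admits a dense irregular manifold, i.e. there is a dense vector subspace $Y\subset X$ such that every non-zero $y\in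 Y$ satisfies $\liminf_{n\to\infty}\|B_w^ny\|=0$ and $\limsup_{n\to\infty}\|B_w^ny\|=\infty$; 5. $B_w$ is densely uniformly Li-Yorke chaotic, i.e. there are a dense uncountable set $S\subset X$ and two sequences $(p_n)$, $(q_n)$ in $\mathbb{N}$ such that for all $x,y\in S$ with $x\neq y$, $\lim_{n\to\infty}\|B_w^{p_n}x-B_w^{p_n}y\|=0$ and $\lim_{n\to\infty}\|B_w^{q_n}x-B_w^{q_n}y\|=\infty$. -/

import Mathlib

open Filter Topology
open scoped ENNReal ZeroAtInfty

noncomputable section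

section MetricDynamics

variable {X : Type*} [MetricSpace X]

/-- `(x, y)` is a Li-Yorke scrambled pair for `f`. The extended distance is used, so that the
liminf and the limsup are taken in `[0, ∞]`. -/
def IsLiYorkePair (f : X → X) (x y : X) : Prop :=
  liminf (fun n : ℕ => edist (f^[n] x) (f^[n] y)) atTop = 0 ∧
    0 < limsup (fun n : ℕ => edist (f^[n] x) (f^[n] y)) atTop

/-- A Li-Yorke scrambled set: at least two points, all pairs of distinct points scrambled. -/
def IsLiYorkeScrambled (f : X → X) (S : Set X) : Prop :=
  S.Nontrivial ∧ ∀ x ∈ S, ∀ y ∈ S, x ≠ y → IsLiYorkePair f x y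

/-- Li-Yorke chaos: there is an uncountable Li-Yorke scrambled set. -/
def IsLiYorkeChaotic (f : X → X) : Prop :=
  ∃ S : Set X, ¬ S.Countable ∧ IsLiYorkeScrambled f S

/-- A uniformly Li-Yorke scrambled set: the two sequences of times are common to all pairs. -/
def IsUniformlyLiYorkeScrambled (f : X → X) (S : Set X) : Prop :=
  S.Nontrivial ∧ ∃ p q : ℕ → ℕ, ∀ x ∈ S, ∀ y ∈ S, x ≠ y →
    Tendsto (fun n => dist (f^[p n] x) (f^[p n] y)) atTop (𝓝 0) ∧
    Tendsto (fun n => dist (f^[q n] x) (f^[q n] y)) atTop atTop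

/-- Dense uniform Li-Yorke chaos: there is a dense, uncountable, uniformly Li-Yorke scrambled
set. -/
def IsDenselyUniformlyLiYorkeChaotic (f : X → X) : Prop :=
  ∃ S : Set X, Dense S ∧ ¬ S.Countable ∧ IsUniformlyLiYorkeScrambled f S

end MetricDynamics

section LinearDynamics

variable {𝕜 : Type*} [RCLike 𝕜] {X : Type*} [NormedAddCommGroup X] [NormedSpace 𝕜 X]

/-- `x` is an irregular vector for the operator `T` (liminf and limsup in `[0, ∞]`). -/
def IsIrregularVector (T : X →L[𝕜] X) (x : X) : Prop :=
  liminf (fun n : ℕ => ‖T^[n] x‖ₑ) atTop = 0 ∧ limsup (fun n : ℕ => ‖T^[n] x‖ₑ) atTop = ∞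

/-- A vector subspace all of whose non-zero vectors are irregular for `T`. -/
def IsIrregularManifold (T : X →L[𝕜] X) (Y : Submodule 𝕜 X) : Prop :=
  ∀ y ∈ Y, y ≠ 0 → IsIrregularVector T y

/-- `T` admits a dense irregular manifold. -/
def AdmitsDenseIrregularManifold (T : X →L[𝕜] X) : Prop :=
  ∃ Y : Submodule 𝕜 X, Dense (Y : Set X) ∧ IsIrregularManifold T Y

end LinearDynamics

section WeightedShift

variable {𝕜 : Type*} [RCLike 𝕜]

/-- The bilateral backward weighted shift on all two-sided sequences: `x ↦ (w_{n+1} x_{n+1})_n`. -/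
def backwardShiftSeq (w : ℤ → 𝕜) (x : ℤ → 𝕜) : ℤ → 𝕜 :=
  fun n => w (n + 1) * x (n + 1)

theorem sum_backwardShiftSeq_le {p : ℝ≥0∞} (hp : 0 < p.toReal) {w : ℤ → 𝕜} {C : ℝ} (hC : 0 ≤ C)
    (hw : ∀ j, ‖w j‖ ≤ C) (x : lp (fun _ : ℤ => 𝕜) p) (s : Finset ℤ) :
    ∑ i ∈ s, ‖backwardShiftSeq w x i‖ ^ p.toReal ≤ (C * ‖x‖) ^ p.toReal := by
  have h := lp.sum_rpow_le_norm_rpow hp x (s.map (Equiv.addRight (1 : ℤ)).toEmbedding)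
  rw [Finset.sum_map] at h
  rw [Real.mul_rpow hC (lp.norm_nonneg' x)]
  refine le_trans ?_ (mul_le_mul_of_nonneg_left h (Real.rpow_nonneg hC _))
  rw [Finset.mul_sum]
  refine Finset.sum_le_sum fun i _ => ?_
  rw [← Real.mul_rpow hC (norm_nonneg _)]
  refine Real.rpow_le_rpow (norm_nonneg _) ?_ hp.le
  simpa [backwardShiftSeq] using
    mul_le_mul_of_nonneg_right (hw (i + 1)) (norm_nonneg (x (i + 1)))

theorem norm_backwardShiftSeq_le {w : ℤ → 𝕜} {C D : ℝ} (hw : ∀ j, ‖w j‖ ≤ C) {x : ℤ → 𝕜}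
    (hx : ∀ j, ‖x j‖ ≤ D) (i : ℤ) : ‖backwardShiftSeq w x i‖ ≤ C * D := by
  rw [backwardShiftSeq, norm_mul]
  exact mul_le_mul (hw _) (hx _) (norm_nonneg _) ((norm_nonneg _).trans (hw 0))

theorem memℓp_backwardShiftSeq {p : ℝ≥0∞} [Fact (1 ≤ p)] {w : ℤ → 𝕜}
    (hw : ∃ C, ∀ j, ‖w j‖ ≤ C) (x : lp (fun _ : ℤ => 𝕜) p) :
    Memℓp (backwardShiftSeq w x) p := by
  obtain ⟨C, hC⟩ := hw
  have hp0 : p ≠ 0 := (zero_lt_one.trans_le (Fact.out : 1 ≤ p)).ne'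
  rcases p.trichotomy with rfl | rfl | hp
  · exact absurd rfl hp0
  · refine memℓp_infty ⟨C * ‖x‖, ?_⟩
    rintro _ ⟨i, rfl⟩
    exact norm_backwardShiftSeq_le hC (lp.norm_apply_le_norm hp0 x) i
  · exact memℓp_gen' (sum_backwardShiftSeq_le hp ((norm_nonneg _).trans (hC 0)) hC x)

/-- The bilateral backward weighted shift `B_w` as a bounded operator on `ℓ^p(ℤ)`, for a bounded
weight sequence `w`. -/
def lpBackwardShift (p : ℝ≥0∞) [Fact (1 ≤ p)] (w : ℤ → 𝕜) (hw : ∃ C, ∀ j, ‖w j‖ ≤ C) :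
    lp (fun _ : ℤ => 𝕜) p →L[𝕜] lp (fun _ : ℤ => 𝕜) p :=
  LinearMap.mkContinuousOfExistsBound
    { toFun := fun x => ⟨backwardShiftSeq w x, memℓp_backwardShiftSeq hw x⟩
      map_add' := fun x y => by
        exact lp.ext (funext fun n => mul_add (w (n + 1)) (x (n + 1)) (y (n + 1)))
      map_smul' := fun c x => by
        ext n
        simp [backwardShiftSeq, mul_left_comm] }
    (by
      obtain ⟨C, hC⟩ := hw
      have hC0 : 0 ≤ C := (norm_nonneg _).trans (hC 0)
      have hp0 : p ≠ 0 := (zero_lt_one.trans_le (Fact.out : 1 ≤ p)).ne'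
      refine ⟨C, fun x => ?_⟩
      rcases p.trichotomy with rfl | rfl | hp
      · exact absurd rfl hp0
      · exact lp.norm_le_of_forall_le (mul_nonneg hC0 (norm_nonneg _))
          fun i => norm_backwardShiftSeq_le hC (lp.norm_apply_le_norm hp0 x) i
      · exact lp.norm_le_of_forall_sum_le hp (mul_nonneg hC0 (norm_nonneg _))
          (sum_backwardShiftSeq_le hp hC0 hC x))

theorem lpBackwardShift_apply (p : ℝ≥0∞) [Fact (1 ≤ p)] (w : ℤ → 𝕜) (hw : ∃ C, ∀ j, ‖w j‖ ≤ C)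
    (x : lp (fun _ : ℤ => 𝕜) p) (n : ℤ) :
    lpBackwardShift p w hw x n = w (n + 1) * x (n + 1) := rfl

theorem tendsto_backwardShiftSeq {w : ℤ → 𝕜} (hw : ∃ C, ∀ j, ‖w j‖ ≤ C) (x : C₀(ℤ, 𝕜)) :
    Tendsto (backwardShiftSeq w x) (cocompact ℤ) (𝓝 0) := by
  obtain ⟨C, hC⟩ := hw
  have h1 : Tendsto (fun n : ℤ => x (n + 1)) (cocompact ℤ) (𝓝 0) :=
    (zero_at_infty x).comp (Homeomorph.addRight (1 : ℤ)).isClosedEmbedding.tendsto_cocompact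
  refine squeeze_zero_norm (fun n => ?_) (by simpa using h1.norm.const_mul C)
  rw [backwardShiftSeq, norm_mul]
  exact mul_le_mul_of_nonneg_right (hC _) (norm_nonneg _)

/-- The bilateral backward weighted shift `B_w` as a bounded operator on `c_0(ℤ)`, for a bounded
weight sequence `w`. Here `c_0(ℤ)` is `C₀(ℤ, 𝕜)` (sequences tending to zero along the complements
of finite sets, with the sup norm), as `ℤ` is discrete. -/
def c0BackwardShift (w : ℤ → 𝕜) (hw : ∃ C, ∀ j, ‖w j‖ ≤ C) : C₀(ℤ, 𝕜) →L[𝕜] C₀(ℤ, 𝕜) :=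
  LinearMap.mkContinuousOfExistsBound
    { toFun := fun x =>
        ⟨⟨backwardShiftSeq w x, continuous_of_discreteTopology⟩, tendsto_backwardShiftSeq hw x⟩
      map_add' := fun x y => by
        ext n
        simp [backwardShiftSeq, mul_add]
      map_smul' := fun c x => by
        ext n
        simp [backwardShiftSeq, mul_left_comm] }
    (by
      obtain ⟨C, hC⟩ := hw
      have hC0 : 0 ≤ C := (norm_nonneg _).trans (hC 0)
      refine ⟨C, fun x => ?_⟩
      rw [← ZeroAtInftyContinuousMap.norm_toBCF_eq_norm]
      refine (BoundedContinuousFunction.norm_le (mul_nonneg hC0 (norm_nonneg _))).2 fun i => ?_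
      exact norm_backwardShiftSeq_le hC (fun j => x.toBCF.norm_coe_le_norm j) i)

theorem c0BackwardShift_apply (w : ℤ → 𝕜) (hw : ∃ C, ∀ j, ‖w j‖ ≤ C) (x : C₀(ℤ, 𝕜)) (n : ℤ) :
    c0BackwardShift w hw x n = w (n + 1) * x (n + 1) := rfl

/-- `liminf_n ∏_{j=-n+1}^{0} |w_j| = 0` and `sup_{k ∈ ℤ, n ∈ ℕ} ∏_{j=k}^{k+n} |w_j| = ∞`, both
computed in `[0, ∞]`. -/
def WeightCondition (w : ℤ → 𝕜) : Prop :=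
  liminf (fun n : ℕ => ∏ j ∈ Finset.Icc (-(n : ℤ) + 1) 0, ‖w j‖ₑ) atTop = 0 ∧
    (⨆ (k : ℤ) (n : ℕ), ∏ j ∈ Finset.Icc k (k + n), ‖w j‖ₑ) = ∞

end WeightedShift

end

/-! ### Lower and upper limits of non-negative real sequences -/

/-! Both spaces enter only through `IsShiftModel`; the core is 2 → 1 and 1 → 4, 5.

Let z be the difference of a scrambled pair. A nonzero coordinate z_k bounds the orbit below by
|z_k| times the weight products starting at k, so these have liminf 0; moving the starting point to
0 changes only boundedly many factors. If all weight products were at most M, every power of the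
shift would have norm at most M, and an orbit that comes near 0 would stay there, so the limsup
would vanish.

Conversely, `exists_sequences` gives distinct coordinates k_n and small vectors v_n = ε_n e_{k_n}
with ‖T^{p_m} v_n‖ ≤ 2^{-m-n}, while T^{q_n} stretches v_n in modulus to at least 2^{n²}. A
polynomial f is sent to a finite combination of unit vectors, given by its coefficients, plus the
series ∑ f(2^{-n-1}) v_n. Near 0 a nonzero f decays at most like a power, so the values f(2^{-n-1})
cannot offset 2^{n²}: every nonzero image is irregular along the same p and q. The image of X^j is
within 2^{1-j} of the j-th prescribed unit vector, and each unit vector is prescribed infinitely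
often, so the range is dense. -/

theorem liminf_ofReal_eq_zero_iff {a : ℕ → ℝ} :
    liminf (fun n => ENNReal.ofReal (a n)) atTop = 0 ↔
      ∀ ε : ℝ, 0 < ε → ∃ᶠ n in atTop, a n < ε := by
  rw [← nonpos_iff_eq_zero, liminf_le_iff]
  constructor
  · intro h ε hε
    exact (h (ENNReal.ofReal ε) (ENNReal.ofReal_pos.2 hε)).mono fun n hn =>
      (ENNReal.ofReal_lt_ofReal_iff hε).1 hn
  · intro h y hy
    obtain ⟨r, hr0, hr⟩ := ENNReal.lt_iff_exists_nnreal_btwn.1 hy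
    have hr0 : (0 : ℝ) < r := by simpa using hr0
    refine (h r hr0).mono fun n hn => lt_trans ?_ hr
    rw [← ENNReal.ofReal_coe_nnreal]
    exact (ENNReal.ofReal_lt_ofReal_iff hr0).2 hn

theorem limsup_ofReal_eq_top {a : ℕ → ℝ} (h : ∀ M : ℝ, ∃ᶠ n in atTop, M ≤ a n) :
    limsup (fun n => ENNReal.ofReal (a n)) atTop = ∞ := by
  refine ENNReal.eq_top_of_forall_nnreal_le fun r => ?_
  refine le_limsup_of_frequently_le' ((h r).mono fun n hn => ?_)
  rw [← ENNReal.ofReal_coe_nnreal]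
  exact ENNReal.ofReal_le_ofReal hn

theorem limsup_ofReal_eq_zero {a : ℕ → ℝ} (h : Tendsto a atTop (𝓝 0)) :
    limsup (fun n => ENNReal.ofReal (a n)) atTop = 0 := by
  have := (ENNReal.tendsto_ofReal h).limsup_eq
  simpa using this

theorem frequently_le_of_tendsto_comp_atTop {a : ℕ → ℝ} {q : ℕ → ℕ}
    (h : Tendsto (a ∘ q) atTop atTop) (M : ℝ) : ∃ᶠ n in atTop, M ≤ a n := by
  rw [frequently_atTop]
  intro N
  obtain ⟨B, hB⟩ := ((Set.finite_lt_nat N).image a).bddAbove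
  obtain ⟨n, hn⟩ := (h.eventually (eventually_gt_atTop (max B M))).exists
  refine ⟨q n, ?_, ((le_max_right _ _).trans_lt hn).le⟩
  by_contra hlt
  exact absurd (hB ⟨q n, not_le.1 hlt, rfl⟩) (not_le.2 ((le_max_left _ _).trans_lt hn))

/-- Here `p` need not tend to infinity. If `a` vanishes once it vanishes from then on; otherwise
finitely many initial values are bounded away from 0, which forces `p n` past them. -/
theorem frequently_lt_of_tendsto_comp_zero {a : ℕ → ℝ} {p : ℕ → ℕ} (h0 : ∀ n, 0 ≤ a n)
    (hs : ∀ n, a n = 0 → a (n + 1) = 0) (h : Tendsto (a ∘ p) atTop (𝓝 0)) {ε : ℝ} (hε : 0 < ε) :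
    ∃ᶠ n in atTop, a n < ε := by
  by_cases hz : ∃ m, a m = 0
  · obtain ⟨m, hm⟩ := hz
    refine Eventually.frequently ((eventually_ge_atTop m).mono fun n hn => ?_)
    have : a n = 0 := Nat.le_induction hm (fun n _ => hs n) n hn
    rwa [this]
  push Not at hz
  have hpos : ∀ n, 0 < a n := fun n => lt_of_le_of_ne (h0 n) (hz n).symm
  rw [frequently_atTop]
  intro N
  have hsmall : ∀ᶠ n in atTop, ∀ m ∈ Finset.range N, (a ∘ p) n < a m :=
    (Finset.eventually_all _).2 fun m _ => h.eventually (gt_mem_nhds (hpos m))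
  obtain ⟨n, hn, hn'⟩ := (hsmall.and (h.eventually (gt_mem_nhds hε))).exists
  refine ⟨p n, ?_, hn'⟩
  by_contra hlt
  exact lt_irrefl _ (hn (p n) (Finset.mem_range.2 (not_le.1 hlt)))

/-! ### Relations between the notions of Li-Yorke chaos -/

section MetricDynamics

variable {X : Type*} [MetricSpace X] {f : X → X}

theorem isLiYorkePair_of_tendsto {x y : X} {p q : ℕ → ℕ}
    (hp : Tendsto (fun n => dist (f^[p n] x) (f^[p n] y)) atTop (𝓝 0))
    (hq : Tendsto (fun n => dist (f^[q n] x) (f^[q n] y)) atTop atTop) : IsLiYorkePair f x y := by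
  let a : ℕ → ℝ := fun n => dist (f^[n] x) (f^[n] y)
  simp only [IsLiYorkePair, edist_dist]
  constructor
  · refine liminf_ofReal_eq_zero_iff.2 fun ε hε =>
      frequently_lt_of_tendsto_comp_zero (a := a) (fun n => dist_nonneg) (fun n hn => ?_) hp hε
    simp only [a, Function.iterate_succ_apply', dist_eq_zero] at hn ⊢
    rw [hn]
  · rw [limsup_ofReal_eq_top (frequently_le_of_tendsto_comp_atTop (a := a) hq)]
    exact ENNReal.zero_lt_top

theorem IsDenselyUniformlyLiYorkeChaotic.isLiYorkeChaotic
    (h : IsDenselyUniformlyLiYorkeChaotic f) : IsLiYorkeChaotic f := by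
  obtain ⟨S, -, hS, hnt, p, q, hpq⟩ := h
  exact ⟨S, hS, hnt, fun x hx y hy hxy =>
    isLiYorkePair_of_tendsto (hpq x hx y hy hxy).1 (hpq x hx y hy hxy).2⟩

theorem IsLiYorkeChaotic.exists_isLiYorkePair (h : IsLiYorkeChaotic f) :
    ∃ x y, IsLiYorkePair f x y := by
  obtain ⟨S, -, ⟨x, hx, y, hy, hxy⟩, hS⟩ := h
  exact ⟨x, y, hS x hx y hy hxy⟩

end MetricDynamics

section LinearDynamics

variable {𝕜 : Type*} [RCLike 𝕜] {X : Type*} [NormedAddCommGroup X] [NormedSpace 𝕜 X]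

theorem ContinuousLinearMap.dist_iterate (T : X →L[𝕜] X) (n : ℕ) (x y : X) :
    dist (T^[n] x) (T^[n] y) = ‖T^[n] (x - y)‖ := by
  rw [dist_eq_norm, ← FunLike.coe_pow_eq_iterate, map_sub]

theorem AdmitsDenseIrregularManifold.exists_isLiYorkePair [Nontrivial X] {T : X →L[𝕜] X}
    (h : AdmitsDenseIrregularManifold T) : ∃ x y, IsLiYorkePair T x y := by
  obtain ⟨Y, hd, hY⟩ := h
  obtain ⟨y, hy, hy0⟩ := hd.exists_mem_open isOpen_compl_singleton (exists_ne (0 : X))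
  obtain ⟨h1, h2⟩ := hY y hy hy0
  refine ⟨y, 0, ?_⟩
  simp only [IsLiYorkePair, edist_dist, T.dist_iterate, sub_zero, ofReal_norm]
  exact ⟨h1, by rw [h2]; exact ENNReal.zero_lt_top⟩

/-- Every non-zero vector of `Y` has orbit tending to zero along `p` and to infinity along `q`. -/
def IsUniformlyIrregular (T : X →L[𝕜] X) (Y : Submodule 𝕜 X) (p q : ℕ → ℕ) : Prop :=
  ∀ y ∈ Y, y ≠ 0 → Tendsto (fun n => ‖T^[p n] y‖) atTop (𝓝 0) ∧
    Tendsto (fun n => ‖T^[q n] y‖) atTop atTop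

variable {T : X →L[𝕜] X} {Y : Submodule 𝕜 X} {p q : ℕ → ℕ}

theorem IsUniformlyIrregular.isIrregularManifold (h : IsUniformlyIrregular T Y p q) :
    IsIrregularManifold T Y := by
  intro y hy hy0
  obtain ⟨hp, hq⟩ := h y hy hy0
  let a : ℕ → ℝ := fun n => ‖T^[n] y‖
  simp only [IsIrregularVector, ← ofReal_norm]
  refine ⟨liminf_ofReal_eq_zero_iff.2 fun ε hε =>
    frequently_lt_of_tendsto_comp_zero (a := a) (fun n => norm_nonneg _) (fun n hn => ?_) hp hε,
    limsup_ofReal_eq_top (frequently_le_of_tendsto_comp_atTop (a := a) hq)⟩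
  simp only [a, Function.iterate_succ_apply', norm_eq_zero] at hn ⊢
  rw [hn, map_zero]

theorem Submodule.not_countable_of_ne_bot (hY : Y ≠ ⊥) : ¬ (Y : Set X).Countable := by
  obtain ⟨y, hy, hy0⟩ := Y.exists_mem_ne_zero_of_ne_bot hY
  intro hc
  have hinj : Function.Injective fun r : ℝ => (r : 𝕜) • y := fun r s hrs =>
    RCLike.ofReal_injective (smul_left_injective 𝕜 hy0 hrs)
  have := hc.preimage_of_injOn (f := fun r : ℝ => (r : 𝕜) • y) hinj.injOn
  rw [Set.eq_univ_of_forall (s := (fun r : ℝ => (r : 𝕜) • y) ⁻¹' Y)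
    fun r => Y.smul_mem _ hy] at this
  exact Set.not_countable_univ this

theorem IsUniformlyIrregular.isDenselyUniformlyLiYorkeChaotic [Nontrivial X]
    (h : IsUniformlyIrregular T Y p q) (hd : Dense (Y : Set X)) :
    IsDenselyUniformlyLiYorkeChaotic T := by
  obtain ⟨y, hy, hy0⟩ := hd.exists_mem_open isOpen_compl_singleton (exists_ne (0 : X))
  refine ⟨Y, hd, Submodule.not_countable_of_ne_bot ((Submodule.ne_bot_iff _).2 ⟨y, hy, hy0⟩),
    ⟨y, hy, 0, Y.zero_mem, hy0⟩, p, q, fun x hx z hz hxz => ?_⟩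
  simp only [T.dist_iterate]
  exact h _ (Y.sub_mem hx hz) (sub_ne_zero.2 hxz)

end LinearDynamics

/-! ### Products of consecutive weights -/

section Weights

variable {𝕜 : Type*} [RCLike 𝕜] {w : ℤ → 𝕜}

/-- The product `w_k w_{k-1} ⋯ w_{k-n+1}` of `n` consecutive weights, going down from `w_k`. -/
def weightProd (w : ℤ → 𝕜) (k : ℤ) (n : ℕ) : 𝕜 := ∏ i ∈ Finset.range n, w (k - i)

theorem weightProd_zero (k : ℤ) : weightProd w k 0 = 1 := by simp [weightProd]

theorem weightProd_succ (k : ℤ) (n : ℕ) :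
    weightProd w k (n + 1) = weightProd w k n * w (k - n) := by
  simp [weightProd, Finset.prod_range_succ]

theorem weightProd_add (k : ℤ) (m n : ℕ) :
    weightProd w k (m + n) = weightProd w k m * weightProd w (k - m) n := by
  simp [weightProd, Finset.prod_range_add, sub_sub]

theorem weightProd_ne_zero (hw0 : ∀ j, w j ≠ 0) (k : ℤ) (n : ℕ) : weightProd w k n ≠ 0 :=
  Finset.prod_ne_zero_iff.2 fun _ _ => hw0 _

theorem norm_weightProd_le {C : ℝ} (hw : ∀ j, ‖w j‖ ≤ C) (k : ℤ) (n : ℕ) :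
    ‖weightProd w k n‖ ≤ C ^ n := by
  rw [weightProd, norm_prod]
  simpa using Finset.prod_le_prod (s := Finset.range n) (fun i _ => norm_nonneg (w (k - i)))
    fun i _ => hw (k - i)

theorem prod_Icc_enorm_eq (k : ℤ) (n : ℕ) :
    ∏ j ∈ Finset.Icc (k - n + 1) k, ‖w j‖ₑ = ENNReal.ofReal ‖weightProd w k n‖ := by
  rw [weightProd, norm_prod, ENNReal.ofReal_prod_of_nonneg fun _ _ => norm_nonneg _]
  simp only [ofReal_norm]
  symm
  refine Finset.prod_bij (fun i _ => k - i) ?_ ?_ ?_ ?_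
  · intro i hi
    simp only [Finset.mem_range, Finset.mem_Icc] at *
    omega
  · intro i _ j _ hij
    omega
  · intro j hj
    simp only [Finset.mem_Icc] at hj
    exact ⟨(k - j).toNat, Finset.mem_range.2 (by omega), by omega⟩
  · intro i _
    rfl

theorem weightCondition_iff : WeightCondition w ↔
    (∀ ε : ℝ, 0 < ε → ∃ᶠ n in atTop, ‖weightProd w 0 n‖ < ε) ∧
      ∀ M : ℝ, ∃ k n, M < ‖weightProd w k n‖ := by
  rw [WeightCondition, ← liminf_ofReal_eq_zero_iff]
  have h1 (n : ℕ) : ∏ j ∈ Finset.Icc (-(n : ℤ) + 1) 0, ‖w j‖ₑ =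
      ENNReal.ofReal ‖weightProd w 0 n‖ := by
    rw [← prod_Icc_enorm_eq, zero_sub]
  have h2 (k : ℤ) (n : ℕ) : ∏ j ∈ Finset.Icc k (k + n), ‖w j‖ₑ =
      ENNReal.ofReal ‖weightProd w (k + n) (n + 1)‖ := by
    rw [← prod_Icc_enorm_eq]
    congr 2
    push_cast
    ring
  simp only [h1, h2]
  refine and_congr_right fun _ => ⟨fun h M => ?_, fun h => ?_⟩
  · have hM : ENNReal.ofReal M < ⨆ (k : ℤ) (n : ℕ),
        ENNReal.ofReal ‖weightProd w (k + n) (n + 1)‖ := h ▸ ENNReal.ofReal_lt_top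
    simp only [lt_iSup_iff] at hM
    obtain ⟨k, n, hkn⟩ := hM
    exact ⟨_, _, (ENNReal.ofReal_lt_ofReal_iff'.1 hkn).1⟩
  · refine ENNReal.eq_top_of_forall_nnreal_le fun r => ?_
    -- The maximum with 1 excludes the empty product, which the supremum over `Icc k (k + n)` does
    -- not contain.
    obtain ⟨k, n, hkn⟩ := h (max r 1)
    cases n with
    | zero =>
      rw [weightProd_zero, norm_one] at hkn
      exact absurd (le_max_right _ _) (not_le.2 hkn)
    | succ n =>
      refine le_iSup₂_of_le (k - n) n ?_
      rw [sub_add_cancel, ← ENNReal.ofReal_coe_nnreal]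
      exact ENNReal.ofReal_le_ofReal ((le_max_left _ _).trans hkn.le)

/-- With `M` above `F`, the `M + n` weights down from `m` and the `n` weights down from 0 differ in
a number of factors independent of `n`. One time thus serves all of `F`. -/
theorem exists_forall_norm_weightProd_le {C : ℝ} (hw : ∀ j, ‖w j‖ ≤ C) (hw0 : ∀ j, w j ≠ 0)
    (h : ∀ ε : ℝ, 0 < ε → ∃ᶠ n in atTop, ‖weightProd w 0 n‖ < ε) (F : Finset ℤ) {δ : ℝ}
    (hδ : 0 < δ) : ∃ p, ∀ m ∈ F, ‖weightProd w m p‖ ≤ δ := by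
  have hC : 0 ≤ C := (norm_nonneg _).trans (hw 0)
  obtain ⟨M, hM⟩ : ∃ M : ℕ, ∀ m ∈ F, m ≤ M := by
    obtain ⟨B, hB⟩ := F.bddAbove
    exact ⟨B.toNat, fun m hm => (hB hm).trans (Int.self_le_toNat B)⟩
  have hbound : ∀ m ∈ F, ∃ c : ℝ, ∀ n, ‖weightProd w m (M + n)‖ ≤ c * ‖weightProd w 0 n‖ := by
    intro m hm
    obtain ⟨l, hl⟩ : ∃ l : ℕ, m - M = 0 - l :=
      ⟨(M - m).toNat, by have := hM m hm; omega⟩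
    refine ⟨‖weightProd w m M‖ * (C ^ l / ‖weightProd w 0 l‖), fun n => ?_⟩
    have h1 : weightProd w 0 l * weightProd w (0 - l) n =
        weightProd w 0 n * weightProd w (0 - n) l := by
      rw [← weightProd_add, ← weightProd_add, add_comm]
    have h2 : ‖weightProd w (0 - l) n‖ ≤ C ^ l / ‖weightProd w 0 l‖ * ‖weightProd w 0 n‖ := by
      have hpos := norm_pos_iff.2 (weightProd_ne_zero hw0 0 l)
      rw [div_mul_eq_mul_div, le_div_iff₀ hpos, mul_comm, ← norm_mul, h1, norm_mul, mul_comm]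
      exact mul_le_mul_of_nonneg_right (norm_weightProd_le hw _ _) (norm_nonneg _)
    rw [weightProd_add, norm_mul, hl, mul_assoc]
    exact mul_le_mul_of_nonneg_left h2 (norm_nonneg _)
  choose! c hc using hbound
  have hev : ∀ᶠ ε in 𝓝[>] (0 : ℝ), ∀ m ∈ F, |c m| * ε < δ := by
    refine (Finset.eventually_all F).2 fun m _ => nhdsWithin_le_nhds ?_
    have : Tendsto (fun ε : ℝ => |c m| * ε) (𝓝 0) (𝓝 (|c m| * 0)) :=
      tendsto_id.const_mul _
    rw [mul_zero] at this
    exact this.eventually (gt_mem_nhds hδ)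
  obtain ⟨ε, hε, hε0⟩ := (hev.and self_mem_nhdsWithin).exists
  obtain ⟨n, hn⟩ := (h ε hε0).exists
  refine ⟨M + n, fun m hm => (hc m hm n).trans ?_⟩
  calc c m * ‖weightProd w 0 n‖ ≤ |c m| * ε :=
        mul_le_mul (le_abs_self _) hn.le (norm_nonneg _) (abs_nonneg _)
    _ ≤ δ := (hε m hm).le

/-- A bound for starting points outside `F` passes to each `k` in `F`: start above `F` and divide by
the fixed product down to `k`. Finitely many such bounds have a common one. -/
theorem exists_notMem_lt_norm_weightProd (hw0 : ∀ j, w j ≠ 0)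
    (h : ∀ M : ℝ, ∃ k n, M < ‖weightProd w k n‖) (F : Finset ℤ) (M : ℝ) :
    ∃ k ∉ F, ∃ n, M < ‖weightProd w k n‖ := by
  by_contra! hcon
  have hb : ∀ k, ∃ b : ℝ, ∀ n, ‖weightProd w k n‖ ≤ b := by
    intro k
    obtain ⟨B, hB⟩ := F.bddAbove
    obtain ⟨l, hl⟩ : ∃ l : ℕ, B < k + l := ⟨(B - k).toNat + 1, by omega⟩
    have hl' : k + l ∉ F := fun hmem => absurd (hB hmem) (not_le.2 hl)
    refine ⟨M / ‖weightProd w (k + l) l‖, fun n => ?_⟩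
    rw [le_div_iff₀ (norm_pos_iff.2 (weightProd_ne_zero hw0 _ _)), mul_comm, ← norm_mul]
    have := hcon _ hl' (l + n)
    rwa [weightProd_add, add_sub_cancel_right] at this
  choose b hb using hb
  obtain ⟨k, n, hkn⟩ := h (max M (∑ k ∈ F, b k))
  refine absurd hkn (not_lt.2 ?_)
  by_cases hk : k ∈ F
  · exact (hb k n).trans ((Finset.single_le_sum (f := b)
      (fun i _ => (norm_nonneg _).trans (hb i 0)) hk).trans (le_max_right _ _))
  · exact (hcon k hk n).trans (le_max_left _ _)

end Weights

/-! ### Values of polynomials along a geometric sequence -/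

/-- Write f = X^r g with g(0) ≠ 0. Then 2^{n²} 2^{-(n+1)r} ≥ 2^n for n ≥ 2r + 1, and g tends to
g(0). -/
theorem tendsto_two_pow_mul_norm_eval {𝕜 : Type*} [RCLike 𝕜] {f : Polynomial 𝕜} (hf : f ≠ 0) :
    Tendsto (fun n : ℕ => (2 : ℝ) ^ (n * n) * ‖f.eval ((1 / 2 : 𝕜) ^ (n + 1))‖) atTop atTop := by
  obtain ⟨g, hg, hg0⟩ := f.exists_eq_pow_rootMultiplicity_mul_and_not_dvd hf 0
  generalize f.rootMultiplicity 0 = r at hg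
  rw [Polynomial.dvd_iff_isRoot, Polynomial.IsRoot.def] at hg0
  have ht : Tendsto (fun n : ℕ => (1 / 2 : 𝕜) ^ (n + 1)) atTop (𝓝 0) :=
    (tendsto_pow_atTop_nhds_zero_of_norm_lt_one (by simp; norm_num)).comp (tendsto_add_atTop_nat 1)
  have hgt : Tendsto (fun n : ℕ => ‖g.eval ((1 / 2 : 𝕜) ^ (n + 1))‖) atTop (𝓝 ‖g.eval 0‖) :=
    ((g.continuous.tendsto 0).comp ht).norm
  have h2 : Tendsto (fun n : ℕ => (2 : ℝ) ^ n) atTop atTop :=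
    tendsto_pow_atTop_atTop_of_one_lt one_lt_two
  refine tendsto_atTop_mono' _ ?_ (h2.atTop_mul_pos (norm_pos_iff.2 hg0) hgt)
  filter_upwards [eventually_ge_atTop (2 * r + 1)] with n hn
  have hexp : n + (n + 1) * r ≤ n * n := by nlinarith
  rw [hg]
  simp only [map_zero, sub_zero, Polynomial.eval_mul, Polynomial.eval_pow, Polynomial.eval_X,
    norm_mul, norm_pow, ← mul_assoc]
  refine mul_le_mul_of_nonneg_right ?_ (norm_nonneg _)
  have h12 : ‖(1 / 2 : 𝕜)‖ = 1 / 2 := by simp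
  rw [h12, ← pow_mul, one_div, inv_pow, ← div_eq_mul_inv, le_div_iff₀ (by positivity), ← pow_add]
  exact pow_le_pow_right₀ one_le_two hexp

theorem exists_norm_eval_le {𝕜 : Type*} [RCLike 𝕜] (f : Polynomial 𝕜) :
    ∃ B : ℝ, ∀ n : ℕ, ‖f.eval ((1 / 2 : 𝕜) ^ (n + 1))‖ ≤ B := by
  obtain ⟨B, hB⟩ := (isCompact_closedBall (0 : 𝕜) 1).exists_bound_of_continuousOn
    f.continuous.continuousOn
  refine ⟨B, fun n => hB _ ?_⟩
  rw [mem_closedBall_zero_iff, norm_pow]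
  exact pow_le_one₀ (norm_nonneg _) (by simp; norm_num)

/-! ### Weighted shifts on abstract sequence spaces -/

section ShiftModel

variable {𝕜 : Type*} [RCLike 𝕜] {X : Type*} [NormedAddCommGroup X] [NormedSpace 𝕜 X]

/-- `T` is the backward shift with weights `w` on a space `X` of two-sided sequences with unit
vectors `e k` and coordinates `π k`, whose norm is shift-invariant and monotone in the moduli of
the coordinates. -/
structure IsShiftModel (w : ℤ → 𝕜) (T : X →L[𝕜] X) (e : ℤ → X) (π : ℤ → X →L[𝕜] 𝕜) : Prop where
  norm_coord_le : ∀ k x, ‖π k x‖ ≤ ‖x‖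
  norm_unit_le : ∀ k, ‖e k‖ ≤ 1
  coord_unit : ∀ k m, π k (e m) = if k = m then 1 else 0
  coord_apply : ∀ k x, π k (T x) = w (k + 1) * π (k + 1) x
  norm_le : ∀ (x y : X) (n : ℤ) (C : ℝ), 0 ≤ C →
    (∀ k, ‖π k x‖ ≤ C * ‖π (k + n) y‖) → ‖x‖ ≤ C * ‖y‖
  dense_span : Dense (Submodule.span 𝕜 (Set.range e) : Set X)

namespace IsShiftModel

variable {w : ℤ → 𝕜} {T : X →L[𝕜] X} {e : ℤ → X} {π : ℤ → X →L[𝕜] 𝕜}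

theorem eq_zero (h : IsShiftModel w T e π) {x : X} (hx : ∀ k, π k x = 0) : x = 0 := by
  have := h.norm_le x x 0 0 le_rfl fun k => by simp [hx k]
  rw [zero_mul] at this
  exact norm_le_zero_iff.1 this

theorem coord_pow (h : IsShiftModel w T e π) (n : ℕ) (k : ℤ) (x : X) :
    π k ((T ^ n) x) = weightProd w (k + n) n * π (k + n) x := by
  induction n generalizing x with
  | zero => simp [weightProd_zero]
  | succ n ih =>
    have h1 : weightProd w (k + (n + 1 : ℕ)) (n + 1) =
        weightProd w (k + n) n * w (k + n + 1) := by
      rw [add_comm n 1, weightProd_add, weightProd_succ, weightProd_zero, mul_comm, one_mul]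
      push_cast
      congr 2 <;> ring
    rw [pow_succ, mul_apply_eq_comp, ih, h.coord_apply, h1, mul_assoc]
    push_cast
    rw [add_assoc]

theorem pow_unit (h : IsShiftModel w T e π) (n : ℕ) (k : ℤ) :
    (T ^ n) (e k) = weightProd w k n • e (k - n) := by
  rw [← sub_eq_zero]
  refine h.eq_zero fun j => ?_
  rw [map_sub, map_smul, h.coord_pow, h.coord_unit, h.coord_unit, smul_eq_mul, sub_eq_zero]
  by_cases hj : j + n = k
  · rw [if_pos hj, if_pos (by omega), hj]
  · rw [if_neg hj, if_neg (by omega), mul_zero, mul_zero]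

theorem norm_pow_unit_le (h : IsShiftModel w T e π) (n : ℕ) (k : ℤ) :
    ‖(T ^ n) (e k)‖ ≤ ‖weightProd w k n‖ := by
  rw [h.pow_unit, norm_smul]
  exact mul_le_of_le_one_right (norm_nonneg _) (h.norm_unit_le _)

theorem norm_weightProd_mul_le (h : IsShiftModel w T e π) (n : ℕ) (k : ℤ) (x : X) :
    ‖weightProd w k n‖ * ‖π k x‖ ≤ ‖(T ^ n) x‖ := by
  have := h.norm_coord_le (k - n) ((T ^ n) x)
  rwa [h.coord_pow, sub_add_cancel, norm_mul] at this

theorem norm_pow_le (h : IsShiftModel w T e π) {M : ℝ} (hM : ∀ k n, ‖weightProd w k n‖ ≤ M)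
    (n : ℕ) (x : X) : ‖(T ^ n) x‖ ≤ M * ‖x‖ := by
  refine h.norm_le _ _ n M ((norm_nonneg _).trans (hM 0 0)) fun k => ?_
  rw [h.coord_pow, norm_mul]
  exact mul_le_mul_of_nonneg_right (hM _ _) (norm_nonneg _)

theorem nontrivial (h : IsShiftModel w T e π) : Nontrivial X := by
  refine ⟨e 0, 0, fun h0 => ?_⟩
  have := h.coord_unit 0 0
  rw [h0, map_zero, if_pos rfl] at this
  exact zero_ne_one this

theorem weightCondition_of_isLiYorkePair (h : IsShiftModel w T e π) (hw0 : ∀ j, w j ≠ 0) {x y : X}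
    (hxy : IsLiYorkePair T x y) : WeightCondition w := by
  simp only [IsLiYorkePair, edist_dist, T.dist_iterate] at hxy
  simp only [← FunLike.coe_pow_eq_iterate] at hxy
  obtain ⟨hinf, hsup⟩ := hxy
  rw [liminf_ofReal_eq_zero_iff] at hinf
  set z := x - y
  rw [weightCondition_iff]
  constructor
  · intro ε hε
    obtain ⟨k, hk⟩ : ∃ k, π k z ≠ 0 := by
      by_contra! hcon
      rw [h.eq_zero hcon] at hsup
      simp at hsup
    have hk' := norm_pos_iff.2 hk
    have hcmp : ∃ c : ℝ, 0 < c ∧ ∃ a : ℕ, ∃ b : ℕ, ∀ n,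
        ‖weightProd w 0 (a + n)‖ ≤ c * ‖weightProd w k (b + n)‖ := by
      rcases le_total k 0 with hk0 | hk0
      · obtain ⟨a, ha⟩ : ∃ a : ℕ, k = 0 - a := ⟨(-k).toNat, by omega⟩
        refine ⟨‖weightProd w 0 a‖, norm_pos_iff.2 (weightProd_ne_zero hw0 _ _), a, 0,
          fun n => ?_⟩
        rw [weightProd_add, norm_mul, ha, zero_add]
      · obtain ⟨b, hb⟩ : ∃ b : ℕ, k - b = 0 := ⟨k.toNat, by omega⟩
        have hpos := norm_pos_iff.2 (weightProd_ne_zero hw0 k b)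
        refine ⟨‖weightProd w k b‖⁻¹, inv_pos.2 hpos, 0, b, fun n => ?_⟩
        rw [weightProd_add k, norm_mul, hb, zero_add, inv_mul_cancel_left₀ hpos.ne']
    obtain ⟨c, hc, a, b, hab⟩ := hcmp
    have hfr := hinf (ε / c * ‖π k z‖) (by positivity)
    rw [frequently_atTop] at hfr ⊢
    intro N
    -- The offset `b` makes `n - b` a true subtraction and keeps `a + (n - b)` beyond `N`.
    obtain ⟨n, hn, hnz⟩ := hfr (N + b)
    refine ⟨a + (n - b), by omega, (hab _).trans_lt ?_⟩
    rw [Nat.add_sub_cancel' (by omega), ← lt_div_iff₀' hc]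
    exact lt_of_mul_lt_mul_right ((h.norm_weightProd_mul_le n k z).trans_lt hnz) hk'.le
  -- Bounded weight products give power boundedness, so one small orbit point keeps all later ones
  -- small.
  · by_contra! hcon
    obtain ⟨M, hM⟩ := hcon
    refine hsup.ne' (limsup_ofReal_eq_zero ?_)
    have hM1 : 1 ≤ M := by simpa [weightProd_zero] using hM 0 0
    rw [Metric.tendsto_atTop]
    intro ε hε
    obtain ⟨m, hm⟩ := (hinf (ε / M) (by positivity)).exists
    refine ⟨m, fun n hn => ?_⟩
    obtain ⟨l, rfl⟩ := Nat.exists_eq_add_of_le' hn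
    rw [Real.dist_0_eq_abs, abs_norm, pow_add, mul_apply_eq_comp]
    refine (h.norm_pow_le hM l _).trans_lt ?_
    rwa [← lt_div_iff₀' (by positivity)]

/-- Coordinates `k n`, scaling factors `ε n` and times `p n`, `q n` such that the vectors
`ε n • e (k n)` are small along `p` and large along `q`. -/
theorem exists_sequences (h : IsShiftModel w T e π) (hw : ∃ C : ℝ, ∀ j, ‖w j‖ ≤ C)
    (hw0 : ∀ j, w j ≠ 0) (hc : WeightCondition w) :
    ∃ (k : ℕ → ℤ) (ε : ℕ → ℝ) (p q : ℕ → ℕ), Function.Injective k ∧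
      (∀ n, 0 < ε n ∧ ε n ≤ (1 / 2) ^ n) ∧
      (∀ n, 2 ^ (n * n) ≤ ‖weightProd w (k n) (q n)‖ * ε n) ∧
      (∀ m, Tendsto (fun n => (T ^ p n) (e m)) atTop (𝓝 0)) ∧
      ∀ m n, ε n * ‖(T ^ p m) (e (k n))‖ ≤ (1 / 2) ^ m * (1 / 2) ^ n := by
  obtain ⟨C, hC⟩ := hw
  obtain ⟨hinf, hsup⟩ := weightCondition_iff.1 hc
  -- Each tuple carries its own index `i`, which `r` makes strictly increasing; `r` also controls
  -- old times on the new vector and the new time on old vectors.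
  let P : ℕ × ℤ × ℝ × ℕ × ℕ → Prop := fun ⟨i, k, ε, p, q⟩ =>
    (0 < ε ∧ ε ≤ (1 / 2) ^ i) ∧ 2 ^ (i * i) ≤ ‖weightProd w k q‖ * ε ∧
      (∀ m ∈ Finset.Icc (-(i : ℤ)) i, ‖(T ^ p) (e m)‖ ≤ (1 / 2) ^ i) ∧
      ε * ‖(T ^ p) (e k)‖ ≤ (1 / 2) ^ i * (1 / 2) ^ i
  let r : ℕ × ℤ × ℝ × ℕ × ℕ → ℕ × ℤ × ℝ × ℕ × ℕ → Prop :=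
    fun ⟨i, k, ε, p, _⟩ ⟨i', k', ε', p', _⟩ => i < i' ∧ k ≠ k' ∧
      ε' * ‖(T ^ p) (e k')‖ ≤ (1 / 2) ^ i * (1 / 2) ^ i' ∧
      ε * ‖(T ^ p') (e k)‖ ≤ (1 / 2) ^ i * (1 / 2) ^ i'
  have hstep : ∀ s : Finset (ℕ × ℤ × ℝ × ℕ × ℕ), (∀ x ∈ s, P x) → ∃ y, P y ∧ ∀ x ∈ s, r x y := by
    intro s hs
    obtain ⟨N, hN⟩ : ∃ N : ℕ, ∀ x ∈ s, x.1 < N :=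
      ⟨s.sup (fun x => x.1) + 1, fun x hx =>
        Nat.lt_succ_of_le (Finset.le_sup (f := fun x : ℕ × ℤ × ℝ × ℕ × ℕ => x.1) hx)⟩
    -- Order of choice: `ε` against the earlier times, then a fresh `k` with `q` compensating for
    -- `ε`, and last `p`, which must shrink old and new vectors alike.
    have hev : ∀ᶠ ε in 𝓝[>] (0 : ℝ),
        ∀ x ∈ s, ε * ‖T ^ x.2.2.2.1‖ < (1 / 2) ^ x.1 * (1 / 2) ^ N := by
      refine (Finset.eventually_all s).2 fun x _ => nhdsWithin_le_nhds ?_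
      have : Tendsto (fun ε : ℝ => ε * ‖T ^ x.2.2.2.1‖) (𝓝 0) (𝓝 (0 * ‖T ^ x.2.2.2.1‖)) :=
        tendsto_id.mul_const _
      rw [zero_mul] at this
      exact this.eventually (gt_mem_nhds (by positivity))
    have hev' : ∀ᶠ ε in 𝓝[>] (0 : ℝ), ε < (1 / 2) ^ N :=
      nhdsWithin_le_nhds (gt_mem_nhds (by positivity))
    obtain ⟨ε, ⟨hε, hε1⟩, hε0 : 0 < ε⟩ := ((hev.and hev').and self_mem_nhdsWithin).exists
    obtain ⟨k, hk, q, hq⟩ := exists_notMem_lt_norm_weightProd hw0 hsup (s.image fun x => x.2.1)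
      (2 ^ (N * N) / ε)
    obtain ⟨p, hp⟩ := exists_forall_norm_weightProd_le hC hw0 hinf
      (Finset.Icc (-(N : ℤ)) N ∪ {k} ∪ s.image fun x => x.2.1)
      (show (0 : ℝ) < (1 / 2) ^ N * (1 / 2) ^ N by positivity)
    have hhalf : ∀ i : ℕ, (1 / 2 : ℝ) ^ i ≤ 1 := fun i => pow_le_one₀ (by norm_num) (by norm_num)
    refine ⟨(N, k, ε, p, q), ⟨⟨hε0, hε1.le⟩, ?_, fun m hm => ?_, ?_⟩, ?_⟩
    · exact ((div_lt_iff₀ hε0).1 hq).le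
    · refine (h.norm_pow_unit_le p m).trans ((hp m ?_).trans
        (mul_le_of_le_one_right (by positivity) (hhalf N)))
      exact Finset.mem_union_left _ (Finset.mem_union_left _ hm)
    · refine (mul_le_of_le_one_left (norm_nonneg _) (hε1.le.trans (hhalf N))).trans ?_
      refine (h.norm_pow_unit_le p k).trans (hp k ?_)
      exact Finset.mem_union_left _ (Finset.mem_union_right _ (Finset.mem_singleton_self k))
    · rintro ⟨i, k', ε', p', q'⟩ hx
      have hmem : k' ∈ s.image fun x => x.2.1 := Finset.mem_image_of_mem (fun x => x.2.1) hx
      obtain ⟨⟨hε'0, hε'1⟩, -⟩ := hs _ hx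
      have hiN := hN _ hx
      refine ⟨hiN, fun hkk => hk (hkk ▸ hmem), ?_, ?_⟩
      · refine (mul_le_mul_of_nonneg_left ?_ hε0.le).trans (hε _ hx).le
        exact ((T ^ p').le_opNorm _).trans
          (mul_le_of_le_one_right (norm_nonneg _) (h.norm_unit_le _))
      · refine (mul_le_of_le_one_left (norm_nonneg _) (hε'1.trans (hhalf i))).trans ?_
        refine (h.norm_pow_unit_le p k').trans ((hp k' (Finset.mem_union_right _ hmem)).trans ?_)
        refine mul_le_mul_of_nonneg_right ?_ (by positivity)
        exact pow_le_pow_of_le_one (by norm_num) (by norm_num) hiN.le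
  obtain ⟨f, hP, hr⟩ := exists_seq_of_forall_finset_exists P r hstep
  have hmono : StrictMono fun n => (f n).1 := fun m n hmn => (hr m n hmn).1
  have hge : ∀ n, n ≤ (f n).1 := fun n => hmono.le_apply
  have hanti : ∀ n, (1 / 2 : ℝ) ^ (f n).1 ≤ (1 / 2) ^ n := fun n =>
    pow_le_pow_of_le_one (by norm_num) (by norm_num) (hge n)
  refine ⟨fun n => (f n).2.1, fun n => (f n).2.2.1, fun n => (f n).2.2.2.1,
    fun n => (f n).2.2.2.2, ?_, fun n => ⟨(hP n).1.1, (hP n).1.2.trans (hanti n)⟩, fun n => ?_,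
    fun m => ?_, fun m n => ?_⟩
  · intro m n hmn
    rcases lt_trichotomy m n with hlt | heq | hlt
    · exact absurd hmn (hr m n hlt).2.1
    · exact heq
    · exact absurd hmn.symm (hr n m hlt).2.1
  · exact (pow_le_pow_right₀ one_le_two (Nat.mul_le_mul (hge n) (hge n))).trans (hP n).2.1
  · refine squeeze_zero_norm' (a := fun n : ℕ => (1 / 2 : ℝ) ^ n) ?_
      (tendsto_pow_atTop_nhds_zero_of_lt_one (by norm_num) (by norm_num))
    filter_upwards [eventually_ge_atTop m.natAbs] with n hn
    refine ((hP n).2.2.1 m ?_).trans (hanti n)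
    have := hge n
    rw [Finset.mem_Icc]
    omega
  · have hle : (1 / 2 : ℝ) ^ (f m).1 * (1 / 2) ^ (f n).1 ≤ (1 / 2) ^ m * (1 / 2) ^ n :=
      mul_le_mul (hanti m) (hanti n) (by positivity) (by positivity)
    refine le_trans ?_ hle
    rcases lt_trichotomy m n with hlt | rfl | hlt
    · exact (hr m n hlt).2.2.1
    · exact (hP m).2.2.2
    · rw [mul_comm ((1 / 2 : ℝ) ^ (f m).1)]
      exact (hr n m hlt).2.2.2

end IsShiftModel

/-! ### A subspace parametrised by polynomials -/

theorem summable_eval_smul [CompleteSpace X] {v : ℕ → X} (hv : ∀ n, ‖v n‖ ≤ (1 / 2) ^ n)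
    (f : Polynomial 𝕜) : Summable fun n : ℕ => f.eval ((1 / 2 : 𝕜) ^ (n + 1)) • v n := by
  obtain ⟨B, hB⟩ := exists_norm_eval_le f
  refine Summable.of_norm_bounded (summable_geometric_two.mul_left B) fun n => ?_
  rw [norm_smul]
  exact mul_le_mul (hB n) (hv n) (norm_nonneg _) ((norm_nonneg _).trans (hB n))

/-- The polynomial `f` is sent to `∑ j, f.coeff j • u j + ∑' n, f(2⁻ⁿ⁻¹) • v n`. -/
noncomputable def polynomialSeries [CompleteSpace X] (u v : ℕ → X) (hv : ∀ n, ‖v n‖ ≤ (1 / 2) ^ n) :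
    Polynomial 𝕜 →ₗ[𝕜] X :=
  (Polynomial.basisMonomials 𝕜).constr 𝕜 u +
    { toFun := fun f => ∑' n, f.eval ((1 / 2 : 𝕜) ^ (n + 1)) • v n
      map_add' := fun f g => by
        simp only [Polynomial.eval_add, add_smul]
        exact (summable_eval_smul hv f).tsum_add (summable_eval_smul hv g)
      map_smul' := fun c f => by
        simp only [Polynomial.eval_smul, smul_assoc, RingHom.id_apply]
        exact (summable_eval_smul hv f).tsum_const_smul c }

theorem polynomialSeries_apply [CompleteSpace X] {u v : ℕ → X} (hv : ∀ n, ‖v n‖ ≤ (1 / 2) ^ n)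
    (f : Polynomial 𝕜) : polynomialSeries u v hv f = (Polynomial.basisMonomials 𝕜).constr 𝕜 u f +
      ∑' n, f.eval ((1 / 2 : 𝕜) ^ (n + 1)) • v n := rfl

theorem norm_polynomialSeries_X_pow_sub_le [CompleteSpace X] {u v : ℕ → X}
    (hv : ∀ n, ‖v n‖ ≤ (1 / 2) ^ n) (j : ℕ) :
    ‖polynomialSeries u v hv (Polynomial.X ^ j : Polynomial 𝕜) - u j‖ ≤ (1 / 2) ^ j * 2 := by
  have hb : (Polynomial.basisMonomials 𝕜).constr 𝕜 u (Polynomial.X ^ j) = u j := by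
    have := (Polynomial.basisMonomials 𝕜).constr_basis 𝕜 u j
    simp only [Polynomial.coe_basisMonomials] at this
    rwa [Polynomial.monomial_one_right_eq_X_pow] at this
  rw [polynomialSeries_apply, hb, add_sub_cancel_left]
  refine tsum_of_norm_bounded (hasSum_geometric_two.mul_left _) fun n => ?_
  rw [norm_smul, Polynomial.eval_pow, Polynomial.eval_X, norm_pow, norm_pow]
  refine mul_le_mul ?_ (hv n) (norm_nonneg _) (by positivity)
  have h12 : ‖(1 / 2 : 𝕜)‖ = 1 / 2 := by simp
  rw [h12, ← pow_mul]
  exact pow_le_pow_of_le_one (by norm_num) (by norm_num) (by nlinarith)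

theorem tendsto_eval_smul_tsum [CompleteSpace X] {v : ℕ → X} (hv : ∀ n, ‖v n‖ ≤ (1 / 2) ^ n)
    (T : X →L[𝕜] X) {p : ℕ → ℕ} (hp : ∀ m n, ‖(T ^ p m) (v n)‖ ≤ (1 / 2) ^ m * (1 / 2) ^ n)
    (f : Polynomial 𝕜) :
    Tendsto (fun m => (T ^ p m) (∑' n, f.eval ((1 / 2 : 𝕜) ^ (n + 1)) • v n)) atTop (𝓝 0) := by
  obtain ⟨B, hB⟩ := exists_norm_eval_le f
  have hlim : Tendsto (fun m : ℕ => B * (1 / 2 : ℝ) ^ m * 2) atTop (𝓝 (B * 0 * 2)) :=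
    ((tendsto_pow_atTop_nhds_zero_of_lt_one (by norm_num) (by norm_num)).const_mul _).mul_const _
  rw [mul_zero, zero_mul] at hlim
  refine squeeze_zero_norm (fun m => ?_) hlim
  rw [(T ^ p m).map_tsum (summable_eval_smul hv f)]
  refine tsum_of_norm_bounded (hasSum_geometric_two.mul_left _) fun n => ?_
  rw [map_smul, norm_smul, mul_assoc]
  exact mul_le_mul (hB n) (hp m n) (norm_nonneg _) ((norm_nonneg _).trans (hB n))

/-- The bijection `φ` lists each `e m` at the infinitely many positions `φ (m, l)`, and the image of
`X ^ φ (m, l)` misses `e m` by at most 2 · 2^{-φ(m,l)}. -/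
theorem span_le_topologicalClosure_range_polynomialSeries [CompleteSpace X] {ι : Type*}
    (e : ι → X) (φ : ι × ℕ ≃ ℕ) {v : ℕ → X} (hv : ∀ n, ‖v n‖ ≤ (1 / 2) ^ n) :
    Submodule.span 𝕜 (Set.range e) ≤
      (polynomialSeries (𝕜 := 𝕜) (fun j => e (φ.symm j).1) v hv).range.topologicalClosure := by
  rw [Submodule.span_le]
  rintro _ ⟨m, rfl⟩
  have hφ : Tendsto (fun l => φ (m, l)) atTop atTop :=
    Function.Injective.nat_tendsto_atTop fun a b hab =>
      (Prod.mk.inj (φ.injective hab)).2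
  refine mem_closure_of_tendsto (b := atTop) (f := fun l => polynomialSeries (𝕜 := 𝕜)
    (fun j => e (φ.symm j).1) v hv (Polynomial.X ^ φ (m, l))) ?_
    (Eventually.of_forall fun l => LinearMap.mem_range_self _ _)
  rw [tendsto_iff_norm_sub_tendsto_zero]
  have hlim : Tendsto (fun l : ℕ => (1 / 2 : ℝ) ^ φ (m, l) * 2) atTop (𝓝 (0 * 2)) :=
    ((tendsto_pow_atTop_nhds_zero_of_lt_one (by norm_num) (by norm_num)).comp hφ).mul_const _
  rw [zero_mul] at hlim
  refine squeeze_zero (fun l => norm_nonneg _) (fun l => ?_) hlim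
  simpa using norm_polynomialSeries_X_pow_sub_le (𝕜 := 𝕜) (u := fun j => e (φ.symm j).1) hv
    (φ (m, l))

/-! ### Dense irregular manifolds and the equivalence -/

namespace IsShiftModel

variable {w : ℤ → 𝕜} {T : X →L[𝕜] X} {e : ℤ → X} {π : ℤ → X →L[𝕜] 𝕜}

theorem eventually_coord_eq_zero (h : IsShiftModel w T e π) {x : X}
    (hx : x ∈ Submodule.span 𝕜 (Set.range e)) : ∀ᶠ k in cofinite, π k x = 0 := by
  induction hx using Submodule.span_induction with
  | mem x hx =>
    obtain ⟨m, rfl⟩ := hx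
    filter_upwards [eventually_cofinite_ne m] with k hk
    rw [h.coord_unit, if_neg hk]
  | zero => simp
  | add x y _ _ hx hy =>
    filter_upwards [hx, hy] with k hkx hky
    rw [map_add, hkx, hky, add_zero]
  | smul c x _ hx =>
    filter_upwards [hx] with k hk
    rw [map_smul, hk, smul_zero]

theorem tendsto_pow_of_mem_span {p : ℕ → ℕ}
    (hp : ∀ m, Tendsto (fun n => (T ^ p n) (e m)) atTop (𝓝 0)) {x : X}
    (hx : x ∈ Submodule.span 𝕜 (Set.range e)) : Tendsto (fun n => (T ^ p n) x) atTop (𝓝 0) := by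
  induction hx using Submodule.span_induction with
  | mem x hx =>
    obtain ⟨m, rfl⟩ := hx
    exact hp m
  | zero => simp
  | add x y _ _ hx hy => simpa using hx.add hy
  | smul c x _ hx => simpa using hx.const_smul c

theorem exists_dense_isUniformlyIrregular [CompleteSpace X] (h : IsShiftModel w T e π)
    (hw : ∃ C : ℝ, ∀ j, ‖w j‖ ≤ C) (hw0 : ∀ j, w j ≠ 0) (hc : WeightCondition w) :
    ∃ (Y : Submodule 𝕜 X) (p q : ℕ → ℕ), Dense (Y : Set X) ∧ IsUniformlyIrregular T Y p q := by
  obtain ⟨k, ε, p, q, hk, hε, hbig, hp, hsmall⟩ := h.exists_sequences hw hw0 hc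
  let v : ℕ → X := fun n => (ε n : 𝕜) • e (k n)
  have hεn : ∀ n, ‖(ε n : 𝕜)‖ = ε n := fun n => by
    rw [RCLike.norm_ofReal, abs_of_pos (hε n).1]
  have hv : ∀ n, ‖v n‖ ≤ (1 / 2) ^ n := fun n => by
    rw [norm_smul, hεn]
    exact (mul_le_of_le_one_right (hε n).1.le (h.norm_unit_le _)).trans (hε n).2
  have hvp : ∀ m n, ‖(T ^ p m) (v n)‖ ≤ (1 / 2) ^ m * (1 / 2) ^ n := fun m n => by
    rw [map_smul, norm_smul, hεn]
    exact hsmall m n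
  let φ := Denumerable.eqv (ℤ × ℕ)
  let u : ℕ → X := fun j => e (φ.symm j).1
  let L := polynomialSeries (𝕜 := 𝕜) u v hv
  refine ⟨L.range, p, q, ?_, ?_⟩
  · have := h.dense_span.mono (span_le_topologicalClosure_range_polynomialSeries e φ hv)
    rw [Submodule.topologicalClosure_coe] at this
    exact dense_closure.1 this
  rintro _ ⟨f, rfl⟩ hf
  have hf0 : f ≠ 0 := fun hf0 => hf (by rw [hf0, map_zero])
  have hspan : (Polynomial.basisMonomials 𝕜).constr 𝕜 u f ∈ Submodule.span 𝕜 (Set.range e) := by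
    have hmem := LinearMap.mem_range_self ((Polynomial.basisMonomials 𝕜).constr 𝕜 u) f
    rw [Module.Basis.constr_range] at hmem
    refine Submodule.span_mono ?_ hmem
    rintro _ ⟨j, rfl⟩
    exact Set.mem_range_self _
  simp only [← FunLike.coe_pow_eq_iterate]
  constructor
  · have := (tendsto_pow_of_mem_span hp hspan).add (tendsto_eval_smul_tsum hv T hvp f)
    rw [add_zero] at this
    simpa [L, polynomialSeries_apply] using this.norm
  · refine tendsto_atTop_mono' _ ?_ (tendsto_two_pow_mul_norm_eval hf0)
    -- As `k` is injective, `k n` eventually leaves the finite support of the combination of unit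
    -- vectors; that coordinate then sees only the n-th term of the series.
    have hev := hk.tendsto_cofinite.eventually (h.eventually_coord_eq_zero hspan)
    rw [Nat.cofinite_eq_atTop] at hev
    filter_upwards [hev] with n hn
    have hcoord : π (k n) (L f) = f.eval ((1 / 2 : 𝕜) ^ (n + 1)) * ε n := by
      rw [polynomialSeries_apply, map_add, hn, zero_add,
        (π (k n)).map_tsum (summable_eval_smul hv f), tsum_eq_single n]
      · simp [v, h.coord_unit]
      · intro m hm
        simp [v, h.coord_unit, hk.eq_iff, hm.symm]
    refine le_trans ?_ (h.norm_weightProd_mul_le (q n) (k n) (L f))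
    rw [hcoord, norm_mul, hεn, mul_comm ‖f.eval _‖, ← mul_assoc]
    exact mul_le_mul_of_nonneg_right (hbig n) (norm_nonneg _)

theorem tfae [CompleteSpace X] (h : IsShiftModel w T e π) (hw : ∃ C : ℝ, ∀ j, ‖w j‖ ≤ C)
    (hw0 : ∀ j, w j ≠ 0) :
    List.TFAE [WeightCondition w, ∃ x y, IsLiYorkePair T x y, IsLiYorkeChaotic T,
      AdmitsDenseIrregularManifold T, IsDenselyUniformlyLiYorkeChaotic T] := by
  -- On the zero space 4 would hold vacuously, so 4 → 2 and 1 → 5 need a nonzero vector.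
  have := h.nontrivial
  tfae_have 1 → 4 := fun hc => by
    obtain ⟨Y, p, q, hd, hY⟩ := h.exists_dense_isUniformlyIrregular hw hw0 hc
    exact ⟨Y, hd, hY.isIrregularManifold⟩
  tfae_have 1 → 5 := fun hc => by
    obtain ⟨Y, p, q, hd, hY⟩ := h.exists_dense_isUniformlyIrregular hw hw0 hc
    exact hY.isDenselyUniformlyLiYorkeChaotic hd
  tfae_have 5 → 3 := fun hc => hc.isLiYorkeChaotic
  tfae_have 4 → 2 := fun hc => hc.exists_isLiYorkePair
  tfae_have 3 → 2 := fun hc => hc.exists_isLiYorkePair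
  tfae_have 2 → 1 := fun ⟨_, _, hxy⟩ => h.weightCondition_of_isLiYorkePair hw0 hxy
  tfae_finish

end IsShiftModel

end ShiftModel

/-! ### The spaces `ℓ^p(ℤ)` and `c_0(ℤ)` -/

section Spaces

variable {𝕜 : Type*} [RCLike 𝕜]

theorem isShiftModel_lpBackwardShift (p : ℝ≥0∞) [Fact (1 ≤ p)] (hp : p ≠ ∞) (w : ℤ → 𝕜)
    (hw : ∃ C : ℝ, ∀ j, ‖w j‖ ≤ C) :
    IsShiftModel w (lpBackwardShift p w hw) (fun k => lp.single p k (1 : 𝕜))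
      (fun k => lp.evalCLM 𝕜 (fun _ : ℤ => 𝕜) p k) := by
  have hp0 : 0 < p := zero_lt_one.trans_le Fact.out
  have hpr : 0 < p.toReal := ENNReal.toReal_pos hp0.ne' hp
  refine ⟨fun k x => lp.norm_apply_le_norm hp0.ne' x k, fun k => ?_, fun k m => ?_,
    fun k x => rfl, fun x y n C hC hxy => ?_, ?_⟩
  · rw [lp.norm_single hp0, norm_one]
  · change lp.single (E := fun _ : ℤ => 𝕜) p m (1 : 𝕜) k = _
    rw [lp.single_apply, Pi.single_apply]
  · refine lp.norm_le_of_forall_sum_le hpr (mul_nonneg hC (norm_nonneg _)) fun s => ?_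
    -- Translating the finite index set by `n` absorbs the shift between `x` and `y`.
    have h := lp.sum_rpow_le_norm_rpow hpr y (s.map (Equiv.addRight n).toEmbedding)
    rw [Finset.sum_map] at h
    rw [Real.mul_rpow hC (norm_nonneg _)]
    refine le_trans ?_ (mul_le_mul_of_nonneg_left h (Real.rpow_nonneg hC _))
    rw [Finset.mul_sum]
    refine Finset.sum_le_sum fun i _ => ?_
    rw [← Real.mul_rpow hC (norm_nonneg _)]
    exact Real.rpow_le_rpow (norm_nonneg _) (hxy i) hpr.le
  · intro x
    refine mem_closure_of_tendsto (lp.hasSum_single hp x) (Eventually.of_forall fun s => ?_)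
    refine Submodule.sum_mem _ fun i _ => ?_
    have : lp.single (E := fun _ : ℤ => 𝕜) p i (x i) = x i • lp.single p i (1 : 𝕜) := by
      rw [← lp.single_smul, smul_eq_mul, mul_one]
    rw [this]
    exact Submodule.smul_mem _ _ (Submodule.subset_span (Set.mem_range_self i))

/-- The two-sided sequence in `c_0(ℤ)` with value `a` at `k` and zero elsewhere. -/
noncomputable def c0Single (k : ℤ) (a : 𝕜) : C₀(ℤ, 𝕜) :=
  ⟨⟨Pi.single k a, continuous_of_discreteTopology⟩, by
    rw [cocompact_eq_cofinite]
    refine tendsto_const_nhds.congr' ?_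
    filter_upwards [eventually_cofinite_ne k] with j hj
    exact (Pi.single_eq_of_ne (M := fun _ : ℤ => 𝕜) hj a).symm⟩

theorem c0Single_apply (k : ℤ) (a : 𝕜) (j : ℤ) : c0Single k a j = if j = k then a else 0 :=
  Pi.single_apply k a j

theorem c0_norm_le {x : C₀(ℤ, 𝕜)} {C : ℝ} (hC : 0 ≤ C) (h : ∀ k, ‖x k‖ ≤ C) : ‖x‖ ≤ C := by
  rw [← ZeroAtInftyContinuousMap.norm_toBCF_eq_norm]
  exact (BoundedContinuousFunction.norm_le hC).2 h

theorem c0_norm_apply_le (x : C₀(ℤ, 𝕜)) (k : ℤ) : ‖x k‖ ≤ ‖x‖ := by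
  rw [← ZeroAtInftyContinuousMap.norm_toBCF_eq_norm]
  exact x.toBCF.norm_coe_le_norm k

/-- The `k`-th coordinate functional on `c_0(ℤ)`. -/
noncomputable def c0EvalCLM (k : ℤ) : C₀(ℤ, 𝕜) →L[𝕜] 𝕜 :=
  LinearMap.mkContinuous
    { toFun := fun x => x k
      map_add' := fun _ _ => rfl
      map_smul' := fun _ _ => rfl } 1 fun x => by
    rw [one_mul]
    exact c0_norm_apply_le x k

theorem c0EvalCLM_apply (k : ℤ) (x : C₀(ℤ, 𝕜)) : c0EvalCLM k x = x k := rfl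

theorem isShiftModel_c0BackwardShift (w : ℤ → 𝕜) (hw : ∃ C : ℝ, ∀ j, ‖w j‖ ≤ C) :
    IsShiftModel w (c0BackwardShift w hw) (fun k => c0Single k (1 : 𝕜)) c0EvalCLM := by
  refine ⟨fun k x => c0_norm_apply_le x k, fun k => c0_norm_le zero_le_one fun j => ?_,
    fun k m => c0Single_apply m 1 k, fun k x => rfl, fun x y n C hC hxy => ?_, fun x => ?_⟩
  · rw [c0Single_apply]
    split_ifs <;> simp
  · exact c0_norm_le (mul_nonneg hC (norm_nonneg _)) fun k =>
      (hxy k).trans (mul_le_mul_of_nonneg_left (c0_norm_apply_le y _) hC)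
  · rw [Metric.mem_closure_iff]
    intro ε hε
    have hfin : {k | ¬ ‖x k‖ < ε / 2}.Finite := by
      have h0 := (zero_at_infty x).norm
      rw [norm_zero, cocompact_eq_cofinite] at h0
      exact eventually_cofinite.1 (h0.eventually (gt_mem_nhds (half_pos hε)))
    refine ⟨∑ k ∈ hfin.toFinset, x k • c0Single k (1 : 𝕜), Submodule.sum_mem _ fun k _ =>
      Submodule.smul_mem _ _ (Submodule.subset_span (Set.mem_range_self k)), ?_⟩
    rw [dist_eq_norm]
    refine (c0_norm_le (half_pos hε).le fun j => ?_).trans_lt (half_lt_self hε)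
    have hj : (∑ k ∈ hfin.toFinset, x k • c0Single k (1 : 𝕜)) j =
        if j ∈ hfin.toFinset then x j else 0 := by
      rw [← c0EvalCLM_apply, map_sum]
      simp [c0EvalCLM_apply, c0Single_apply]
    rw [ZeroAtInftyContinuousMap.sub_apply, hj]
    split_ifs with hmem
    · simpa using (half_pos hε).le
    · rw [Set.Finite.mem_toFinset, Set.mem_ofPred_eq, not_not] at hmem
      simpa using hmem.le

end Spaces

theorem mainTheorem2 {𝕜 : Type*} [RCLike 𝕜] (w : ℤ → 𝕜) (hw : ∃ C : ℝ, ∀ j, ‖w j‖ ≤ C)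
    (hw0 : ∀ j, w j ≠ 0) :
    (∀ (p : ℝ≥0∞) [Fact (1 ≤ p)], p ≠ ∞ →
      List.TFAE
        [WeightCondition w,
          ∃ x y : lp (fun _ : ℤ => 𝕜) p, IsLiYorkePair (lpBackwardShift p w hw) x y,
          IsLiYorkeChaotic (lpBackwardShift p w hw),
          AdmitsDenseIrregularManifold (lpBackwardShift p w hw),
          IsDenselyUniformlyLiYorkeChaotic (lpBackwardShift p w hw)]) ∧
      List.TFAE
        [WeightCondition w,
          ∃ x y : C₀(ℤ, 𝕜), IsLiYorkePair (c0BackwardShift w hw) x y,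
          IsLiYorkeChaotic (c0BackwardShift w hw),
          AdmitsDenseIrregularManifold (c0BackwardShift w hw),
          IsDenselyUniformlyLiYorkeChaotic (c0BackwardShift w hw)] := by
  exact ⟨fun p _ hp => (isShiftModel_lpBackwardShift p hp w hw).tfae hw hw0,
    (isShiftModel_c0BackwardShift w hw).tfae hw hw0⟩
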